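/- Let $n,t$ be natural numbers and let $\mathbb R[\bar X]^{t\times t}$ be the ring of real $t\times t$ matrix polynomials in $n$ commuting variables $\bar X=(X_1,\dots,X_n)$, with the transpose as involution $p\mapsto p^*$. Let $G$ be a (possibly infinite) set of symmetric elements of $\mathbb R[\bar X]^{t\times t}$, let $$S_G=\{x\in\mathbb R^n\mid g(x)\succeq 0\text{ for all }g\in G\},$$ where $A\succeq 0$ means that the real matrix $A$ is symmetric positive semidefinite, and let $$M_G=\Big\{\sum_{i=1}^N p_i^*g_ip_i\ \Big|\ N\ge 1,\ g_i\in\{1\}\cup G,\ p_i\in\mathbb R[\bar X]^{t\times t}\Big\}$$ be the quadratic module generated by $G$. Suppose that $M_G$ is archimedean, i.e. for every $a\in\mathbb R[\bar X]^{t\times t}$ there is a positive integer $N$ with $N-a^*a\in M_G$ (scalars are identified with scalar multiples of the identity matrix). Then for every symmetric $f\in\mathbb R[\bar X]^{t\times t}$ the following are equivalent: (i) $f(x)\succeq 0$ for all $x\in S_G$; (ii) $f+\varepsilon\in M_G$ for every real $\varepsilon>0$. -/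

import Mathlib

namespace MatrixPoly

/-- Real `t × t` matrix polynomials in `n` commuting variables. The involution on this ring is
the transpose (the coefficient ring carries the trivial involution), so that the symmetric
elements are those satisfying `Matrix.IsSymm`. -/
abbrev MatPoly (n t : ℕ) : Type := Matrix (Fin t) (Fin t) (MvPolynomial (Fin n) ℝ)

/-- The value `f(x)` of a matrix polynomial at a point `x` of `ℝⁿ`: entrywise evaluation. -/
noncomputable def evalAt {n t : ℕ} (x : Fin n → ℝ) (f : MatPoly n t) :
    Matrix (Fin t) (Fin t) ℝ :=
  f.map (MvPolynomial.eval x)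

/-- `S_G`: the points of `ℝⁿ` where every element of `G` is positive semidefinite. -/
def posSet {n t : ℕ} (G : Set (MatPoly n t)) : Set (Fin n → ℝ) :=
  {x | ∀ g ∈ G, (evalAt x g).PosSemidef}

/-- `M_G`: the quadratic module generated by `G`, i.e. the set of all finite sums of elements
`p* g p` with `g ∈ {1} ∪ G` and `p` an arbitrary matrix polynomial. -/
def quadModule {n t : ℕ} (G : Set (MatPoly n t)) : Set (MatPoly n t) :=
  {f | ∃ N : ℕ, 0 < N ∧ ∃ g p : Fin N → MatPoly n t,
    (∀ i, g i ∈ ({1} ∪ G : Set (MatPoly n t))) ∧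
      f = ∑ i, (p i).transpose * g i * p i}

/-- `M` is archimedean: for every matrix polynomial `a` (symmetric or not) there is a positive
integer `N` with `N - a* a ∈ M`. -/
def IsArchimedean {n t : ℕ} (M : Set (MatPoly n t)) : Prop :=
  ∀ a : MatPoly n t, ∃ N : ℕ, 0 < N ∧ (N : MatPoly n t) - a.transpose * a ∈ M

end MatrixPoly

open MvPolynomial Matrix

namespace MatrixPoly

variable {n t : ℕ} {G : Set (MatPoly n t)}

/-! If `f + ε` were outside the quadratic module, a state `L` would satisfy `L f ≤ -ε`. The
archimedean condition makes the state set compact, so `L` may be taken extreme. An extreme state is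
multiplicative over the central scalars `ℝ[X]`, hence factors through evaluation at some `x`.
Positivity on the module forces `x` into `posSet G`, so `f(x)` is positive semidefinite and `L f = L
(f(x)) ≥ 0`, a contradiction.

The crux is multiplicativity: `L` must split into the states proportional to `a ↦ L (c² a)` and its
complement. The complement needs `L (c² a) ≤ N * L a`, although `(N - c²) a` need not lie in the
module; `IsState.map_sq_smul_le` supplies it by a growth argument. -/

/-! ### The quadratic module and its cone -/

theorem add_mem_quadModule {a b : MatPoly n t} (ha : a ∈ quadModule G) (hb : b ∈ quadModule G) :
    a + b ∈ quadModule G := by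
  obtain ⟨N, hN, g, p, hg, rfl⟩ := ha
  obtain ⟨N', hN', g', p', hg', rfl⟩ := hb
  refine ⟨N + N', by omega, Fin.append g g', Fin.append p p', fun i => ?_, ?_⟩
  · refine Fin.addCases (fun j => ?_) (fun j => ?_) i
    · rw [Fin.append_left]; exact hg j
    · rw [Fin.append_right]; exact hg' j
  · simp [Fin.sum_univ_add]

theorem conj_mem_quadModule {a : MatPoly n t} (ha : a ∈ quadModule G) (q : MatPoly n t) :
    qᵀ * a * q ∈ quadModule G := by
  obtain ⟨N, hN, g, p, hg, rfl⟩ := ha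
  refine ⟨N, hN, g, fun i => p i * q, hg, ?_⟩
  simp [Finset.mul_sum, Finset.sum_mul, Matrix.mul_assoc]

theorem transpose_mul_mul_mem_quadModule {g : MatPoly n t} (hg : g ∈ ({1} ∪ G : Set (MatPoly n t)))
    (p : MatPoly n t) : pᵀ * g * p ∈ quadModule G :=
  ⟨1, one_pos, fun _ => g, fun _ => p, fun _ => hg, by simp⟩

theorem transpose_mul_self_mem_quadModule (p : MatPoly n t) : pᵀ * p ∈ quadModule G := by
  simpa using transpose_mul_mul_mem_quadModule (G := G) (Or.inl rfl) p

theorem smul_mem_quadModule {a : MatPoly n t} (ha : a ∈ quadModule G) {r : ℝ} (hr : 0 ≤ r) :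
    r • a ∈ quadModule G := by
  have h := conj_mem_quadModule ha (Real.sqrt r • 1)
  simpa [smul_smul, Real.mul_self_sqrt hr] using h

theorem sq_smul_mem_quadModule {a : MatPoly n t} (ha : a ∈ quadModule G)
    (c : MvPolynomial (Fin n) ℝ) : c ^ 2 • a ∈ quadModule G := by
  have h := conj_mem_quadModule ha (c • 1)
  simpa [smul_smul, sq] using h

theorem isSymm_of_mem_quadModule (hG : ∀ g ∈ G, g.IsSymm) {a : MatPoly n t}
    (ha : a ∈ quadModule G) : a.IsSymm := by
  obtain ⟨N, hN, g, p, hg, rfl⟩ := ha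
  have h : ∀ i, (g i)ᵀ = g i := fun i => by
    rcases hg i with h | h
    · rw [Set.mem_singleton_iff.mp h, transpose_one]
    · exact hG _ h
  simp [Matrix.IsSymm, transpose_sum, Matrix.mul_assoc, h]

variable (G) in
/-- The cone of all matrix polynomials whose symmetrization lies in the quadratic module. -/
noncomputable def symCone : PointedCone ℝ (MatPoly n t) where
  carrier := {a | a + aᵀ ∈ quadModule G}
  zero_mem' := by simpa using transpose_mul_self_mem_quadModule (G := G) (0 : MatPoly n t)
  add_mem' {a b} ha hb := by
    have := add_mem_quadModule ha hb
    simpa [add_add_add_comm] using this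
  smul_mem' r a ha := by
    have := smul_mem_quadModule ha r.2
    simpa using! this

theorem mem_symCone {a : MatPoly n t} : a ∈ symCone G ↔ a + aᵀ ∈ quadModule G := Iff.rfl

theorem mem_symCone_of_mem (hG : ∀ g ∈ G, g.IsSymm) {a : MatPoly n t} (ha : a ∈ quadModule G) :
    a ∈ symCone G := by
  rw [mem_symCone, (isSymm_of_mem_quadModule hG ha).eq]
  exact add_mem_quadModule ha ha

theorem mem_quadModule_of_mem_symCone {a : MatPoly n t} (ha : a ∈ symCone G) (hs : a.IsSymm) :
    a ∈ quadModule G := by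
  rw [mem_symCone, hs.eq, ← two_smul ℝ] at ha
  simpa [smul_smul] using smul_mem_quadModule ha (r := 1 / 2) (by norm_num)

theorem real_smul_mem_symCone {a : MatPoly n t} (ha : a ∈ symCone G) {r : ℝ} (hr : 0 ≤ r) :
    r • a ∈ symCone G :=
  (symCone G).smul_mem hr ha

theorem sq_smul_mem_symCone {a : MatPoly n t} (ha : a ∈ symCone G)
    (c : MvPolynomial (Fin n) ℝ) : c ^ 2 • a ∈ symCone G := by
  rw [mem_symCone, transpose_smul, ← smul_add]
  exact sq_smul_mem_quadModule ha c

theorem one_mem_symCone (hG : ∀ g ∈ G, g.IsSymm) : (1 : MatPoly n t) ∈ symCone G :=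
  mem_symCone_of_mem hG (by simpa using transpose_mul_self_mem_quadModule (G := G) 1)

/-- For an archimedean quadratic module the identity is an order unit. -/
theorem IsArchimedean.exists_smul_one_add_mem (hM : IsArchimedean (quadModule G))
    (a : MatPoly n t) : ∃ r : ℝ, 0 ≤ r ∧ r • (1 : MatPoly n t) + a ∈ symCone G := by
  obtain ⟨N, -, hN⟩ := hM a
  have h := add_mem_quadModule hN (transpose_mul_self_mem_quadModule (1 + a))
  -- `N - aᵀa + (1 + a)ᵀ(1 + a) = N + 1 + a + aᵀ`, the symmetrization of `(N + 1) / 2 + a`.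
  refine ⟨((N : ℝ) + 1) / 2, by positivity, ?_⟩
  rw [mem_symCone]
  convert h using 1
  have hc : (N : MatPoly n t) = (N : ℝ) • 1 := by
    rw [← Nat.cast_smul_eq_nsmul ℝ N (1 : MatPoly n t) |>.symm]; simp
  rw [hc]
  simp only [transpose_add, transpose_smul, transpose_one, add_mul, mul_add, one_mul, mul_one]
  module

theorem IsArchimedean.exists_sub_sq_mem
    (hM : IsArchimedean (quadModule G)) (c : MvPolynomial (Fin n) ℝ) :
    ∃ r : ℝ, 0 ≤ r ∧ r • (1 : MatPoly n t) - c ^ 2 • 1 ∈ symCone G := by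
  obtain ⟨r, h0, hr⟩ := hM.exists_smul_one_add_mem (-(c ^ 2 • 1))
  exact ⟨r, h0, by rwa [sub_eq_add_neg]⟩

/-- A normalized linear functional that is nonnegative on the quadratic module. -/
structure IsState (G : Set (MatPoly n t)) (L : MatPoly n t →ₗ[ℝ] ℝ) : Prop where
  nonneg : ∀ a ∈ symCone G, 0 ≤ L a
  map_one : L 1 = 1

/-! ### Localizing scalar bounds -/

/-- A log-convex sequence of at most geometric growth with ratio `N` satisfies `u 1 ≤ N * u 0`. -/
theorem le_mul_of_logConvex {u : ℕ → ℝ} {N B : ℝ} (hN : 0 ≤ N) (h0 : ∀ k, 0 ≤ u k)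
    (hu : ∀ k, u (k + 1) ^ 2 ≤ u k * u (k + 2)) (hB : ∀ k, u k ≤ B * N ^ k) :
    u 1 ≤ N * u 0 := by
  by_contra! hlt
  have h1 : 0 < u 1 := lt_of_le_of_lt (mul_nonneg hN (h0 0)) hlt
  have h00 : 0 < u 0 := by
    have := hu 0
    refine (h0 0).lt_of_ne fun h => ?_
    rw [← h] at this
    nlinarith
  have hr : N < u 1 / u 0 := by rwa [lt_div_iff₀ h00]
  set r := u 1 / u 0 with hrdef
  have hr0 : 0 < r := lt_of_le_of_lt hN hr
  -- Log-convexity makes successive ratios nondecreasing, so `u` grows at least like `r ^ k` with `r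
  -- > N`.
  have key : ∀ k, 0 < u k ∧ r * u k ≤ u (k + 1) := by
    intro k
    induction k with
    | zero => exact ⟨h00, by rw [hrdef, div_mul_cancel₀ _ h00.ne']⟩
    | succ k ih =>
      have hk : 0 < u (k + 1) := lt_of_lt_of_le (mul_pos hr0 ih.1) ih.2
      refine ⟨hk, le_of_mul_le_mul_left ?_ ih.1⟩
      calc u k * (r * u (k + 1)) = (r * u k) * u (k + 1) := by ring
        _ ≤ u (k + 1) * u (k + 1) := by gcongr; exact ih.2
        _ ≤ u k * u (k + 2) := by rw [← sq]; exact hu k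
  have geo : ∀ k, u 0 * r ^ k ≤ u k := by
    intro k
    induction k with
    | zero => simp
    | succ k ih =>
      calc u 0 * r ^ (k + 1) = r * (u 0 * r ^ k) := by ring
        _ ≤ r * u k := by gcongr
        _ ≤ _ := (key k).2
  have hle : ∀ k, u 0 ≤ B * (N / r) ^ k := fun k => by
    rw [div_pow, ← mul_div_assoc, le_div_iff₀ (by positivity)]
    exact (geo k).trans (hB k)
  have hlim : Filter.Tendsto (fun k => B * (N / r) ^ k) Filter.atTop (nhds (B * 0)) :=
    (tendsto_pow_atTop_nhds_zero_of_lt_one (by positivity)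
      ((div_lt_one hr0).mpr hr)).const_mul B
  rw [mul_zero] at hlim
  exact absurd (ge_of_tendsto' hlim hle) (not_le.mpr h00)

namespace IsState

variable {L : MatPoly n t →ₗ[ℝ] ℝ}

/-- The quadratic `r ↦ L ((r c + d)² a)` is nonnegative, so its discriminant is at most zero. -/
theorem map_sq_smul_cauchySchwarz (hL : IsState G L) {a : MatPoly n t} (ha : a ∈ symCone G)
    (c d : MvPolynomial (Fin n) ℝ) :
    L ((c * d) • a) ^ 2 ≤ L (c ^ 2 • a) * L (d ^ 2 • a) := by
  have h : ∀ r : ℝ, 0 ≤ L (c ^ 2 • a) * (r * r) + (2 * L ((c * d) • a)) * r + L (d ^ 2 • a) := by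
    intro r
    have := hL.nonneg _ (sq_smul_mem_symCone ha (r • c + d))
    have e : (r • c + d) ^ 2 • a
        = (r * r) • (c ^ 2 • a) + (2 * r) • ((c * d) • a) + d ^ 2 • a := by
      simp only [← smul_assoc, ← add_smul]
      congr 1
      simp only [MvPolynomial.smul_eq_C_mul, map_mul, map_ofNat]
      ring
    rw [e] at this
    simp only [map_add, map_smul, smul_eq_mul] at this
    linarith
  have := discrim_le_zero h
  rw [discrim] at this
  nlinarith

/-- The key estimate: a bound for `c²` modulo the quadratic module localizes to every element of
the cone, although the quadratic module is not closed under multiplication. -/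
theorem map_sq_smul_le (hL : IsState G L) (hM : IsArchimedean (quadModule G))
    {a : MatPoly n t} (ha : a ∈ symCone G) {c : MvPolynomial (Fin n) ℝ} {N : ℝ} (hN : 0 ≤ N)
    (hc : N • (1 : MatPoly n t) - c ^ 2 • 1 ∈ symCone G) :
    L (c ^ 2 • a) ≤ N * L a := by
  -- `B - a` in the cone gives `L (c²ᵏ a) ≤ B * L (c²ᵏ) ≤ B * N ^ k`.
  obtain ⟨B, hB0, hB⟩ := hM.exists_smul_one_add_mem (-a)
  have growth_one : ∀ k, L ((c ^ k) ^ 2 • (1 : MatPoly n t)) ≤ N ^ k := by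
    intro k
    induction k with
    | zero => simp [hL.map_one]
    | succ k ih =>
      have := hL.nonneg _ (sq_smul_mem_symCone hc (c ^ k))
      rw [smul_sub, smul_comm _ N, smul_smul, map_sub, map_smul, smul_eq_mul,
        show (c ^ k) ^ 2 * c ^ 2 = (c ^ (k + 1)) ^ 2 by ring] at this
      rw [pow_succ' N]
      nlinarith [mul_le_mul_of_nonneg_left ih hN]
  have growth : ∀ k, L ((c ^ k) ^ 2 • a) ≤ B * N ^ k := by
    intro k
    have := hL.nonneg _ (sq_smul_mem_symCone hB (c ^ k))
    rw [smul_add, smul_comm _ B, smul_neg, map_add, map_neg, map_smul, smul_eq_mul] at this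
    nlinarith [mul_le_mul_of_nonneg_left (growth_one k) hB0]
  have := le_mul_of_logConvex (u := fun k => L ((c ^ k) ^ 2 • a)) hN
    (fun k => hL.nonneg _ (sq_smul_mem_symCone ha _))
    (fun k => by
      have := hL.map_sq_smul_cauchySchwarz ha (c ^ k) (c ^ (k + 2))
      rwa [show c ^ k * c ^ (k + 2) = (c ^ (k + 1)) ^ 2 by ring] at this) growth
  simpa using this

end IsState


/-! ### Compactness, separation and extreme states -/

variable (G) in
/-- The states, as a subset of the space of all functions with the product topology. -/
def stateSet : Set (MatPoly n t → ℝ) :=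
  {φ | ∃ L : MatPoly n t →ₗ[ℝ] ℝ, IsState G L ∧ ⇑L = φ}

theorem isClosed_stateSet : IsClosed (stateSet G) := by
  have h : stateSet G = {φ : MatPoly n t → ℝ | (∀ a b, φ (a + b) = φ a + φ b) ∧
      (∀ (r : ℝ) a, φ (r • a) = r * φ a) ∧ (∀ a ∈ symCone G, 0 ≤ φ a) ∧ φ 1 = 1} := by
    ext φ
    constructor
    · rintro ⟨L, hL, rfl⟩
      exact ⟨map_add L, fun r a => by simp, hL.nonneg, hL.map_one⟩
    · rintro ⟨h1, h2, h3, h4⟩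
      exact ⟨⟨⟨φ, h1⟩, h2⟩, ⟨h3, h4⟩, rfl⟩
  rw [h]
  simp only [Set.ofPred_and, Set.ofPred_forall]
  refine .inter (isClosed_iInter fun a => isClosed_iInter fun b => ?_) <|
    .inter (isClosed_iInter fun r => isClosed_iInter fun a => ?_) <|
    .inter (isClosed_iInter fun a => isClosed_iInter fun _ => ?_) ?_
  · exact isClosed_eq (by fun_prop) (by fun_prop)
  · exact isClosed_eq (by fun_prop) (by fun_prop)
  · exact isClosed_le (by fun_prop) (by fun_prop)
  · exact isClosed_eq (by fun_prop) (by fun_prop)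

/-- The order unit confines each value `L a` to a fixed interval; Tychonoff applies. -/
theorem isCompact_stateSet (hM : IsArchimedean (quadModule G)) : IsCompact (stateSet G) := by
  choose r _ hr using hM.exists_smul_one_add_mem
  refine (isCompact_univ_pi fun a => isCompact_Icc (a := -r a) (b := r (-a))).of_isClosed_subset
    isClosed_stateSet ?_
  rintro _ ⟨L, hL, rfl⟩ a -
  have h1 := hL.nonneg _ (hr a)
  have h2 := hL.nonneg _ (hr (-a))
  simp only [map_add, map_smul, map_neg, hL.map_one, smul_eq_mul, mul_one] at h1 h2
  exact ⟨by linarith, by linarith⟩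

/-- A symmetric element outside the quadratic module is separated from it by a state. -/
theorem exists_isState_map_nonpos (hG : ∀ g ∈ G, g.IsSymm) (hM : IsArchimedean (quadModule G))
    {h : MatPoly n t} (hs : h.IsSymm) (hh : h ∉ quadModule G) :
    ∃ L : MatPoly n t →ₗ[ℝ] ℝ, IsState G L ∧ L h ≤ 0 := by
  have hh' : h ∉ symCone G := fun H => hh (mem_quadModule_of_mem_symCone H hs)
  have h1 := one_mem_symCone hG
  -- A negative multiple of the order unit would put every element, in particular `h`, in the cone.
  have hneg : ∀ c : ℝ, c < 0 → c • (1 : MatPoly n t) ∉ symCone G := by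
    intro c hc H
    obtain ⟨r, hr0, hr⟩ := hM.exists_smul_one_add_mem h
    have := add_mem hr (real_smul_mem_symCone H (r := r / -c) (div_nonneg hr0 (by linarith)))
    rw [smul_smul, show r / -c * c = -r by rw [div_neg, neg_mul, div_mul_cancel₀ _ hc.ne]] at this
    exact hh' (by convert this using 1; module)
  -- Adjoining `-h` makes any functional nonnegative on `S` satisfy `L h ≤ 0`; Riesz extends `c • 1
  -- ↦ c`.
  let S : PointedCone ℝ (MatPoly n t) := symCone G ⊔ Submodule.span {c : ℝ // 0 ≤ c} {-h}
  have hS : ∀ c : ℝ, c • (1 : MatPoly n t) ∈ S → 0 ≤ c := by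
    intro c hc
    by_contra! hlt
    obtain ⟨y, hy, z, hz, hyz⟩ := Submodule.mem_sup.mp hc
    obtain ⟨⟨s, hs0⟩, rfl⟩ := Submodule.mem_span_singleton.mp hz
    replace hyz : y + s • (-h) = c • 1 := hyz
    rcases hs0.eq_or_lt with rfl | hs0
    · rw [zero_smul, add_zero] at hyz
      exact hneg c hlt (hyz ▸ hy)
    · refine hh' ?_
      have e : h = s⁻¹ • (y + (-c) • (1 : MatPoly n t)) := by
        have : y + (-c) • (1 : MatPoly n t) = s • h := by
          rw [neg_smul, ← hyz]; module
        rw [this, smul_smul, inv_mul_cancel₀ hs0.ne', one_smul]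
      rw [e]
      exact real_smul_mem_symCone (add_mem hy (real_smul_mem_symCone h1 (by linarith)))
        (by positivity)
  have h10 : ∀ c : ℝ, c • (1 : MatPoly n t) = 0 → c = 0 := by
    intro c hc
    refine le_antisymm ?_ (hS c (hc ▸ zero_mem S))
    have := hS (-c) (by rw [neg_smul, hc, neg_zero]; exact zero_mem S)
    linarith
  let p : MatPoly n t →ₗ.[ℝ] ℝ :=
    LinearPMap.mkSpanSingleton' 1 (1 : ℝ) fun c hc => by simp [h10 c hc]
  have hp : ∀ (c : ℝ) (hc : c • (1 : MatPoly n t) ∈ p.domain), p ⟨c • 1, hc⟩ = c := by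
    intro c hc
    have := LinearPMap.mkSpanSingleton'_apply (σ := RingHom.id ℝ) (1 : MatPoly n t) (1 : ℝ)
      (fun c hc => by simp [h10 c hc]) c hc
    simpa only [RingHom.id_apply, smul_eq_mul, mul_one] using! this
  have hdom : ∀ c : ℝ, c • (1 : MatPoly n t) ∈ p.domain := fun c =>
    Submodule.mem_span_singleton.mpr ⟨c, rfl⟩
  obtain ⟨L, hLp, hL⟩ := riesz_extension S p
    (by
      rintro ⟨x, hx⟩ hxS
      obtain ⟨c, rfl⟩ := Submodule.mem_span_singleton.mp hx
      rw [hp]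
      exact hS c hxS)
    (by
      intro y
      obtain ⟨r, -, hr⟩ := hM.exists_smul_one_add_mem y
      exact ⟨⟨r • 1, hdom r⟩, Submodule.mem_sup_left hr⟩)
  refine ⟨L, ⟨fun a ha => hL a (Submodule.mem_sup_left ha), ?_⟩, ?_⟩
  · have := (hLp ⟨_, hdom 1⟩).trans (hp 1 _)
    simpa using this
  · have := hL (-h) (Submodule.mem_sup_right (Submodule.mem_span_singleton_self _))
    rw [map_neg] at this
    linarith

/-- Every value taken by a state is bounded below by the value of an extreme state. -/
theorem exists_mem_extremePoints_le (hM : IsArchimedean (quadModule G))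
    {L : MatPoly n t →ₗ[ℝ] ℝ} (hL : IsState G L) (f : MatPoly n t) :
    ∃ L' : MatPoly n t →ₗ[ℝ] ℝ, ⇑L' ∈ (stateSet G).extremePoints ℝ ∧ L' f ≤ L f := by
  let l : StrongDual ℝ (MatPoly n t → ℝ) := -ContinuousLinearMap.proj f
  have hc := isCompact_stateSet hM
  have hexp : IsExposed ℝ (stateSet G) (l.toExposed (stateSet G)) :=
    ContinuousLinearMap.toExposed.isExposed
  obtain ⟨φ, hφ, hmax⟩ := hc.exists_isMaxOn ⟨_, L, hL, rfl⟩ l.continuous.continuousOn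
  -- The minimizers of evaluation at `f` form a compact face, whose extreme points are extreme in
  -- the whole state set.
  obtain ⟨ψ, hψ⟩ := (hexp.isCompact hc).extremePoints_nonempty ⟨φ, hφ, hmax⟩
  obtain ⟨⟨L', -, rfl⟩, hle⟩ := extremePoints_subset hψ
  refine ⟨L', hexp.isExtreme.extremePoints_subset_extremePoints hψ, ?_⟩
  have := hle L ⟨L, hL, rfl⟩
  simpa [l] using this

variable {L : MatPoly n t →ₗ[ℝ] ℝ}

theorem isState_of_mem_extremePoints (hL : ⇑L ∈ (stateSet G).extremePoints ℝ) : IsState G L := by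
  obtain ⟨L', hL', h⟩ := extremePoints_subset hL
  rwa [← DFunLike.coe_injective h]

/-! ### Extreme states are point evaluations on scalars -/

/-- Multiplication by a scalar polynomial, as a real linear endomorphism. -/
noncomputable def smulMap (c : MvPolynomial (Fin n) ℝ) : MatPoly n t →ₗ[ℝ] MatPoly n t :=
  LinearMap.lsmul (MvPolynomial (Fin n) ℝ) (MatPoly n t) c |>.restrictScalars ℝ

theorem map_sq_smul_of_mem_extremePoints (hM : IsArchimedean (quadModule G))
    (hG : ∀ g ∈ G, g.IsSymm) (hL : ⇑L ∈ (stateSet G).extremePoints ℝ)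
    (c : MvPolynomial (Fin n) ℝ) (a : MatPoly n t) :
    L (c ^ 2 • a) = L (c ^ 2 • 1) * L a := by
  have hst := isState_of_mem_extremePoints hL
  obtain ⟨N, hN, hc⟩ := hM.exists_sub_sq_mem c
  have hle := fun {a} (ha : a ∈ symCone G) => hst.map_sq_smul_le hM ha hN hc
  have h1 := one_mem_symCone hG
  set α := L (c ^ 2 • 1) with hα
  have hα0 : 0 ≤ α := hst.nonneg _ (sq_smul_mem_symCone h1 c)
  have hαN : α ≤ N := by simpa [hst.map_one] using hle h1
  rcases hα0.eq_or_lt with h0 | hpos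
  · obtain ⟨r, -, hr⟩ := hM.exists_smul_one_add_mem a
    obtain ⟨r', -, hr'⟩ := hM.exists_smul_one_add_mem (-a)
    have e := hst.nonneg _ (sq_smul_mem_symCone hr c)
    have e' := hst.nonneg _ (sq_smul_mem_symCone hr' c)
    simp only [smul_add, smul_neg, smul_comm _ r, smul_comm _ r', map_add, map_neg, map_smul,
      ← hα, ← h0, smul_eq_mul] at e e'
    rw [← h0]
    linarith
  -- Using `N + 1` rather than `N` keeps `β` positive even when `α = N`.
  · set β := N + 1 - α with hβ
    have hβ0 : 0 < β := by linarith
    let L₁ : MatPoly n t →ₗ[ℝ] ℝ := α⁻¹ • L ∘ₗ smulMap (c ^ 2)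
    let L₂ : MatPoly n t →ₗ[ℝ] ℝ := β⁻¹ • ((N + 1) • L - L ∘ₗ smulMap (c ^ 2))
    have hL₁ : ∀ a, L₁ a = α⁻¹ * L (c ^ 2 • a) := fun a => rfl
    have hL₂ : ∀ a, L₂ a = β⁻¹ * ((N + 1) * L a - L (c ^ 2 • a)) := fun a => rfl
    have s₁ : IsState G L₁ := by
      refine ⟨fun a ha => ?_, ?_⟩
      · rw [hL₁]
        exact mul_nonneg (by positivity) (hst.nonneg _ (sq_smul_mem_symCone ha c))
      · rw [hL₁, ← hα, inv_mul_cancel₀ hpos.ne']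
    have s₂ : IsState G L₂ := by
      refine ⟨fun a ha => ?_, ?_⟩
      · rw [hL₂]
        have := hle ha
        have := hst.nonneg a ha
        exact mul_nonneg (by positivity) (by linarith)
      · rw [hL₂, ← hα, hst.map_one, mul_one, ← hβ, inv_mul_cancel₀ hβ0.ne']
    have hseg : ⇑L ∈ openSegment ℝ ⇑L₁ ⇑L₂ := by
      refine ⟨α / (N + 1), β / (N + 1), by positivity, by positivity, ?_, ?_⟩
      · rw [hβ]; field_simp; ring
      · funext b
        simp only [Pi.add_apply, Pi.smul_apply, smul_eq_mul, hL₁, hL₂]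
        field_simp
        ring
    have := congrFun (hL.2 ⟨L₁, s₁, rfl⟩ ⟨L₂, s₂, rfl⟩ hseg) a
    rw [hL₁] at this
    rw [← this]
    field_simp

theorem map_smul_of_mem_extremePoints (hM : IsArchimedean (quadModule G))
    (hG : ∀ g ∈ G, g.IsSymm) (hL : ⇑L ∈ (stateSet G).extremePoints ℝ)
    (c : MvPolynomial (Fin n) ℝ) (a : MatPoly n t) :
    L (c • a) = L (c • 1) * L a := by
  have key : ∀ b : MatPoly n t,
      c • b = (1 / 4 : ℝ) • ((c + 1) ^ 2 • b) - (1 / 4 : ℝ) • ((c - 1) ^ 2 • b) := by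
    intro b
    rw [← smul_sub, ← sub_smul, show (c + 1) ^ 2 - (c - 1) ^ 2 = (4 : ℝ) • c by
      rw [MvPolynomial.smul_eq_C_mul, map_ofNat]; ring, smul_assoc, smul_smul]
    norm_num
  rw [key a, key 1]
  simp only [map_sub, map_smul, smul_eq_mul,
    map_sq_smul_of_mem_extremePoints hM hG hL _ a]
  ring

/-- An extreme state factors through evaluation at a point. -/
theorem exists_map_eq_evalAt (hM : IsArchimedean (quadModule G))
    (hG : ∀ g ∈ G, g.IsSymm) (hL : ⇑L ∈ (stateSet G).extremePoints ℝ) :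
    ∃ x : Fin n → ℝ, ∀ a, L a = L ((evalAt x a).map C) := by
  have hst := isState_of_mem_extremePoints hL
  have hmul := map_smul_of_mem_extremePoints hM hG hL
  -- A real character of `ℝ[X]` is evaluation at the images of the variables.
  let χ : MvPolynomial (Fin n) ℝ →ₐ[ℝ] ℝ :=
    AlgHom.ofLinearMap
      (L ∘ₗ ((LinearMap.toSpanSingleton (MvPolynomial (Fin n) ℝ) (MatPoly n t) 1).restrictScalars ℝ))
      (by simp [hst.map_one])
      (fun c d => by
        simp only [LinearMap.comp_apply, LinearMap.restrictScalars_apply,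
          LinearMap.toSpanSingleton_apply]
        rw [mul_smul, hmul])
  have hχ : ∀ c, L (c • 1) = χ c := fun c => rfl
  refine ⟨fun i => χ (X i), fun a => ?_⟩
  have hev : ∀ c, χ c = eval (fun i => χ (X i)) c := by
    intro c
    rw [← MvPolynomial.coe_aeval_eq_eval]
    exact congrArg (fun ψ : MvPolynomial (Fin n) ℝ →ₐ[ℝ] ℝ => ψ c) (MvPolynomial.aeval_unique χ)
  have hs : ∀ (i j : Fin t) (c : MvPolynomial (Fin n) ℝ),
      L (single i j c) = eval (fun i => χ (X i)) c * L (single i j 1) := by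
    intro i j c
    rw [← hev, ← hχ, ← hmul]
    congr 1
    simp [smul_single]
  conv_lhs => rw [matrix_eq_sum_single a]
  conv_rhs => rw [matrix_eq_sum_single ((evalAt _ a).map C)]
  simp only [map_sum]
  refine Finset.sum_congr rfl fun i _ => Finset.sum_congr rfl fun j _ => ?_
  rw [hs, hs]
  simp [evalAt, hs i j (C _)]

theorem exists_map_single_pos (hL : IsState G L) :
    ∃ i : Fin t, 0 < L (single i i 1) := by
  by_contra! h
  have := hL.map_one
  rw [← Matrix.sum_single_one, map_sum] at this
  linarith [Finset.sum_nonpos fun i (_ : i ∈ Finset.univ) => h i]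

/-- With `p = v eᵢᵀ`, `pᵀ g p` takes the value `(vᵀ g(x) v) Eᵢᵢ` at `x`; some `i` has `L Eᵢᵢ > 0`.
-/
theorem mem_posSet_of_map_eq_evalAt (hG : ∀ g ∈ G, g.IsSymm) (hL : IsState G L)
    {x : Fin n → ℝ} (hx : ∀ a, L a = L ((evalAt x a).map C)) : x ∈ posSet G := by
  intro g hg
  obtain ⟨i, hi⟩ := exists_map_single_pos hL
  refine .of_dotProduct_mulVec_nonneg ?_ fun v => ?_
  · rw [IsHermitian, conjTranspose_eq_transpose_of_trivial, evalAt, ← transpose_map, hG g hg]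
  · let p : MatPoly n t := (vecMulVec v (Pi.single i 1)).map C
    have h := hL.nonneg _ (mem_symCone_of_mem hG (transpose_mul_mul_mem_quadModule (Or.inr hg) p))
    have e : (evalAt x (pᵀ * g * p)).map C
        = (star v ⬝ᵥ evalAt x g *ᵥ v) • (single i i 1 : MatPoly n t) := by
      have hp : evalAt x p = vecMulVec v (Pi.single i 1) := by
        ext; simp [p, evalAt]
      have : evalAt x (pᵀ * g * p) = (evalAt x p)ᵀ * evalAt x g * evalAt x p := by
        simp only [evalAt, Matrix.map_mul, transpose_map]
      rw [this, hp, transpose_vecMulVec, vecMulVec_mul, vecMulVec_mul_vecMulVec]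
      rw [star_trivial, dotProduct_mulVec]
      ext1 j k
      rcases eq_or_ne i j with rfl | hj
      · rcases eq_or_ne i k with rfl | hk
        · simp [vecMulVec_apply, MvPolynomial.smul_eq_C_mul]
        · simp [vecMulVec_apply, hk, hk.symm]
      · simp [vecMulVec_apply, hj, hj.symm]
    rw [hx, e, map_smul, smul_eq_mul] at h
    exact nonneg_of_mul_nonneg_left h hi

/-- A positive semidefinite constant matrix factors as `BᵀB`, a square in the module. -/
theorem IsState.map_C_nonneg (hG : ∀ g ∈ G, g.IsSymm) (hL : IsState G L)
    {A : Matrix (Fin t) (Fin t) ℝ} (hA : A.PosSemidef) : 0 ≤ L (A.map C) := by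
  open scoped MatrixOrder ComplexOrder Matrix.Norms.L2Operator in
  obtain ⟨B, rfl⟩ := CStarAlgebra.nonneg_iff_eq_star_mul_self.mp hA.nonneg
  refine hL.nonneg _ (mem_symCone_of_mem hG ?_)
  rw [star_eq_conjTranspose, conjTranspose_eq_transpose_of_trivial, Matrix.map_mul, transpose_map]
  exact transpose_mul_self_mem_quadModule _

theorem posSemidef_evalAt_of_mem_quadModule {a : MatPoly n t} (ha : a ∈ quadModule G)
    {x : Fin n → ℝ} (hx : x ∈ posSet G) : (evalAt x a).PosSemidef := by
  obtain ⟨N, -, g, p, hg, rfl⟩ := ha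
  have e : evalAt x (∑ i, (p i)ᵀ * g i * p i)
      = ∑ i, (evalAt x (p i))ᴴ * evalAt x (g i) * evalAt x (p i) := by
    have (b : MatPoly n t) : evalAt x b = (eval x).mapMatrix b := rfl
    simp only [conjTranspose_eq_transpose_of_trivial, this, map_sum, map_mul]
    rfl
  rw [e]
  refine posSemidef_sum _ fun i _ => PosSemidef.conjTranspose_mul_mul_same ?_ _
  rcases hg i with h | h
  · rw [Set.mem_singleton_iff.mp h]
    have : evalAt x (1 : MatPoly n t) = 1 := (eval x).mapMatrix.map_one
    rw [this]
    exact .one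
  · exact hx _ h

end MatrixPoly

theorem corollary14 (n t : ℕ) (G : Set (MatrixPoly.MatPoly n t))
    (hG : ∀ g ∈ G, g.IsSymm)
    (hM : MatrixPoly.IsArchimedean (MatrixPoly.quadModule G))
    (f : MatrixPoly.MatPoly n t) (hf : f.IsSymm) :
    (∀ x ∈ MatrixPoly.posSet G, (MatrixPoly.evalAt x f).PosSemidef) ↔
      ∀ ε : ℝ, 0 < ε →
        f + ε • (1 : MatrixPoly.MatPoly n t) ∈ MatrixPoly.quadModule G := by
  open MatrixPoly in
  constructor
  · intro h ε hε
    by_contra hmem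
    obtain ⟨L, hL, hLf⟩ := exists_isState_map_nonpos hG hM
      (by rw [Matrix.IsSymm, Matrix.transpose_add, Matrix.transpose_smul, Matrix.transpose_one, hf])
      hmem
    obtain ⟨L', hL', hle⟩ := exists_mem_extremePoints_le hM hL f
    obtain ⟨x, hx⟩ := exists_map_eq_evalAt hM hG hL'
    have hst := isState_of_mem_extremePoints hL'
    have := hst.map_C_nonneg hG (h x (mem_posSet_of_map_eq_evalAt hG hst hx))
    rw [← hx] at this
    rw [map_add, map_smul, hL.map_one, smul_eq_mul, mul_one] at hLf
    linarith
  · intro h x hx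
    refine .of_dotProduct_mulVec_nonneg ?_ fun v => ?_
    · rw [Matrix.IsHermitian, Matrix.conjTranspose_eq_transpose_of_trivial, evalAt,
        ← Matrix.transpose_map, hf]
    -- Positivity of `f(x) + ε` passes to the limit as `ε` decreases to zero.
    · refine ge_of_tendsto (f := fun ε : ℝ => star v ⬝ᵥ evalAt x f *ᵥ v + ε * (star v ⬝ᵥ v))
        (x := nhdsWithin 0 (Set.Ioi 0)) ?_ ?_
      · refine tendsto_nhdsWithin_of_tendsto_nhds ?_
        have : Continuous fun ε : ℝ => star v ⬝ᵥ evalAt x f *ᵥ v + ε * (star v ⬝ᵥ v) := by fun_prop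
        simpa using this.tendsto 0
      · filter_upwards [self_mem_nhdsWithin] with ε hε
        have := (posSemidef_evalAt_of_mem_quadModule (h ε hε) hx).dotProduct_mulVec_nonneg v
        have e : evalAt x (f + ε • 1) = evalAt x f + ε • 1 := by
          ext i j
          by_cases hij : i = j <;> simp [evalAt, hij, MvPolynomial.smul_eval]
        rwa [e, Matrix.add_mulVec, dotProduct_add, Matrix.smul_mulVec, dotProduct_smul,
          Matrix.one_mulVec, smul_eq_mul] at this
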